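/- Let $R$ be an algebraically closed field of characteristic $0$, and let $R((\tau))$ be the field of formal Laurent series over $R$. Let $V$ be a finite-dimensional vector space over $R((\tau))$ with a connection, that is, an $R$-linear map $\nabla = \nabla_{\tau^2\partial_\tau} \colon V \to V$ such that $\nabla(fv) = (\tau^2\partial_\tau f)\,v + f\,\nabla v$ for all $f \in R((\tau))$ and $v \in V$. (For $V = R((\tau))^r$, these are the operators $\tau^2\partial_\tau + A$ with $A$ an arbitrary $r \times r$ matrix over $R((\tau))$.) Then the covariantly constant endomorphisms of $\nabla$, meaning the $R((\tau))$-linear maps $E \colon V \to V$ with $\nabla E = E \nabla$, form a finite-dimensional vector space over $R$. -/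

import Mathlib

/-- The derivation `τ² ∂_τ` of the ring `R((τ))` of formal Laurent series. -/
noncomputable def tauSqDeriv (R : Type*) [CommRing R] (f : LaurentSeries R) : LaurentSeries R :=
  HahnSeries.single (2 : ℤ) (1 : R) * LaurentSeries.derivative R f

/-- A connection over `R((τ))` on the `R((τ))`-module `V`, given by its covariant derivative
`∇ = ∇_{τ² ∂_τ}`: an `R`-linear map which satisfies the Leibniz rule for `τ² ∂_τ`.
On `V = R((τ))^r` these are exactly the operators `τ² ∂_τ + A` with `A` an `r × r` matrix
over `R((τ))`. Because `τ²` is invertible in `R((τ))`, `∇_{τ² ∂_τ}` determines `∇_{g ∂_τ}` for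
every Laurent series `g`. -/
structure LaurentConnection (R : Type*) [CommRing R] (V : Type*) [AddCommGroup V]
    [Module (LaurentSeries R) V] [Module R V] where
  nabla : V →ₗ[R] V
  leibniz : ∀ (f : LaurentSeries R) (v : V), nabla (f • v) = tauSqDeriv R f • v + f • nabla v

/-- An action of `R` on `V` which is the restriction of the action of `R((τ))` commutes with it. -/
instance LaurentSeries.smulCommClass_of_isScalarTower {R : Type*} [CommRing R] {V : Type*}
    [AddCommGroup V] [Module (LaurentSeries R) V] [Module R V]
    [IsScalarTower R (LaurentSeries R) V] : SMulCommClass (LaurentSeries R) R V where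
  smul_comm f c v := by
    have h : ∀ w : V, c • w = (HahnSeries.C c : LaurentSeries R) • w := by
      intro w
      rw [← mul_one (HahnSeries.C c : LaurentSeries R), HahnSeries.C_mul_eq_smul, smul_assoc,
        one_smul]
    rw [h, h, smul_smul, smul_smul, mul_comm]

/-- The `R`-module of covariantly constant endomorphisms: the `R((τ))`-linear endomorphisms of `V`
which commute with the connection. -/
def LaurentConnection.covariantlyConstantEnd {R : Type*} [CommRing R] {V : Type*}
    [AddCommGroup V] [Module (LaurentSeries R) V] [Module R V]
    [IsScalarTower R (LaurentSeries R) V] (C : LaurentConnection R V) :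
    Submodule R (Module.End (LaurentSeries R) V) where
  carrier := {E | ∀ v : V, C.nabla (E v) = E (C.nabla v)}
  add_mem' := by
    intro E F hE hF v
    simp only [Set.mem_ofPred_eq] at hE hF
    simp [hE, hF]
  zero_mem' := by
    intro v
    simp
  smul_mem' := by
    intro c E hE v
    simp only [Set.mem_ofPred_eq] at hE
    simp [hE]

/-! Flat endomorphisms independent over the constants `R` remain independent over `R((τ))`
(`linearIndepOn_laurentSeries`), so their `R`-dimension is at most that of `End V` over `R((τ))`. -/

theorem exists_eq_C_of_tauSqDeriv_eq_zero {R : Type*} [Field R] [CharZero R]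
    {f : LaurentSeries R} (hf : tauSqDeriv R f = 0) : ∃ c : R, f = HahnSeries.C c := by
  have hd : LaurentSeries.derivative R f = 0 := by
    refine (mul_eq_zero.mp hf).resolve_left ?_
    simp
  refine ⟨f.coeff 0, ?_⟩
  ext n
  by_cases hn : n = 0
  · simp [hn]
  -- The derivative has coefficient `n * f.coeff n` at `n - 1`, and `n ≠ 0` in `R`.
  · have h := congrArg (fun g : LaurentSeries R => g.coeff (n - 1)) hd
    simp [LaurentSeries.derivative_apply, LaurentSeries.hasseDeriv_coeff, hn] at h
    simp [HahnSeries.C_apply, HahnSeries.coeff_single_of_ne hn, h]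

namespace LaurentConnection

variable {R : Type*} [Field R] {V : Type*} [AddCommGroup V] [Module (LaurentSeries R) V]
  [Module R V] [IsScalarTower R (LaurentSeries R) V] (C : LaurentConnection R V)

theorem sum_tauSqDeriv_smul_eq_zero (s : Finset (Module.End (LaurentSeries R) V))
    (hs : ∀ E ∈ s, E ∈ C.covariantlyConstantEnd)
    (f : Module.End (LaurentSeries R) V → LaurentSeries R)
    (ha : ∑ E ∈ s, f E • E ∈ C.covariantlyConstantEnd) :
    ∑ E ∈ s, tauSqDeriv R (f E) • E = 0 := by
  ext v
  have h : C.nabla ((∑ E ∈ s, f E • E) v) = (∑ E ∈ s, f E • E) (C.nabla v) := ha v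
  have hE : ∀ E ∈ s, C.nabla (f E • E v) = tauSqDeriv R (f E) • E v + f E • E (C.nabla v) := by
    intro E h
    rw [C.leibniz, show C.nabla (E v) = E (C.nabla v) from hs E h v]
  simp only [LinearMap.sum_apply, LinearMap.smul_apply, map_sum] at h
  rw [Finset.sum_congr rfl hE, Finset.sum_add_distrib] at h
  simpa using h

/-- If `a = ∑ f E • E` over `s`, commuting with `∇` leaves `∑ (τ²∂_τ f E) • E = 0`. By induction
these coefficients vanish, so each `f E` is constant and `a` lies in the `R`-span of `s`. -/
theorem linearIndepOn_laurentSeries [CharZero R] (s : Finset (Module.End (LaurentSeries R) V))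
    (hs : ∀ E ∈ s, E ∈ C.covariantlyConstantEnd)
    (hind : LinearIndepOn R id (s : Set (Module.End (LaurentSeries R) V))) :
    LinearIndepOn (LaurentSeries R) id (s : Set (Module.End (LaurentSeries R) V)) := by
  classical
  induction s using Finset.induction_on with
  | empty => simp
  | insert a s has ih =>
    have hs' : ∀ E ∈ s, E ∈ C.covariantlyConstantEnd := fun E h =>
      hs E (Finset.mem_insert_of_mem h)
    have ha := hs a (Finset.mem_insert_self a s)
    rw [Finset.coe_insert, linearIndepOn_id_insert (by simpa using has)] at hind ⊢
    have hK := ih hs' hind.1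
    refine ⟨hK, fun hmem => hind.2 ?_⟩
    obtain ⟨f, -, rfl⟩ := Submodule.mem_span_finset.mp hmem
    have h0 := linearIndepOn_finset_iff.mp hK (fun E => tauSqDeriv R (f E))
      (C.sum_tauSqDeriv_smul_eq_zero s hs' f ha)
    refine Submodule.sum_mem _ fun E hE => ?_
    obtain ⟨c, hc⟩ := exists_eq_C_of_tauSqDeriv_eq_zero (h0 E hE)
    have hcE : f E • E = c • E := by
      ext v
      rw [hc, LinearMap.smul_apply, LinearMap.smul_apply,
        ← mul_one (HahnSeries.C c : LaurentSeries R), HahnSeries.C_mul_eq_smul, smul_assoc, one_smul]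
    rw [hcE]
    exact Submodule.smul_mem _ c (Submodule.subset_span hE)

end LaurentConnection

theorem mainTheorem5 {R : Type*} [Field R] [IsAlgClosed R] [CharZero R]
    {V : Type*} [AddCommGroup V] [Module (LaurentSeries R) V] [Module R V]
    [IsScalarTower R (LaurentSeries R) V] [FiniteDimensional (LaurentSeries R) V]
    (C : LaurentConnection R V) :
    FiniteDimensional R C.covariantlyConstantEnd := by
  classical
  refine Module.rank_lt_aleph0_iff.mp (lt_of_le_of_lt (rank_le
    (n := Module.finrank (LaurentSeries R) (Module.End (LaurentSeries R) V)) fun s hs => ?_)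
    Cardinal.natCast_lt_aleph0)
  -- The flat endomorphisms form only an `R`-module; `R((τ))`-independence makes sense in `End V`.
  let t := s.map (Function.Embedding.subtype (· ∈ C.covariantlyConstantEnd))
  have ht : LinearIndepOn R id (t : Set (Module.End (LaurentSeries R) V)) := by
    have h : LinearIndepOn R id (s : Set C.covariantlyConstantEnd) := hs
    have h' := h.map' C.covariantlyConstantEnd.subtype (Submodule.ker_subtype _)
    simpa [t] using LinearIndepOn.id_image (v := C.covariantlyConstantEnd.subtype) h'
  have hK := C.linearIndepOn_laurentSeries t (by simp +contextual [t]) ht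
  have hcard := LinearIndependent.fintype_card_le_finrank hK
  simpa only [Finset.coe_sort_coe, Fintype.card_coe, t, Finset.card_map] using hcard
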